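/- Let $(G_i)_{i\in\mathbb N}$ be finite abelian (discrete) groups, let $X=\prod_{i\in\mathbb N}G_i$ carry the product topology, and let $\bigoplus_i G_i\le X$ be the subgroup of finitely supported elements. Let $G\le X$ be a closed subgroup which is order controllable: for every $i$ there is $n_i$ such that for each $c\in G$ there is $c_1\in G$ with $c_1(j)=c(j)$ for all $j\le i$, with $\operatorname{supp}(c_1)\subseteq[1,n_i]$, and such that the order of $c_1$ divides the order of the restriction $c_{|[1,n_i]}$. Let $\mathbb P_G$ be the set of primes $p$ for which $G$ has a nontrivial $p$-subgroup. Terminology. For a countable family $(g_n)$ in $X$, $G$ is topologically generated by $(g_n)$ if all $g_n$ belong to $G\cap\bigoplus_iG_i$, the cyclic subgroups $\langle g_n\rangle$ form a direct sum in $X$, and this direct sum $\bigoplus_n\langle g_n\rangle$ is dense in $G$ (some $g_n$ may be $0$). An isomorphic encoder of $G$ for such a family is an isomorphism of topological groups $\Phi:\prod_n\langle g_n\rangle\to G$ with $\Phi((x_n))=\sum_n x_n$ for $(x_n)\in\bigoplus_n\langle g_n\rangle$. The group $G$ is weakly rectangular if it has an isomorphic encoder for some sequence $(g_n)_{n\in\mathbb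 N}$, and an implicit direct product if it has one that moreover satisfies $\Phi(\bigoplus_n\langle g_n\rangle)=G\cap\bigoplus_iG_i$. A subgroup $H\le X$ is weakly observable if $H\cap\bigoplus_iG_i=\overline H\cap\bigoplus_iG_i$. For an abelian group $K$, $K[p]=\{x\in K: px=0\}$. Then there are elements $y_m^{(p)}$ ($m\in\mathbb N$, $p\in\mathbb P_G$) of $G\cap\bigoplus_iG_i$ such that: (a) $G$ is topologically generated by the family $(y_m^{(p)})_{m\in\mathbb N,\,p\in\mathbb P_G}$, and for each $p\in\mathbb P_G$ every $y_m^{(p)}$, $m\in\mathbb N$, lies in the $p$-primary part of $G\cap\bigoplus_iG_i$. (b) If $G$ has finite exponent, then there is an isomorphic encoder $\Phi:\prod_{m\in\mathbb N,\,p\in\mathbb P_G}\langle y_m^{(p)}\rangle\to G$ and, as a consequence, $G$ is weakly rectangular. (c) If for each $p\in\mathbb P_G$ the subgroup $\bigoplus_{m\in\mathbb N}\langle y_m^{(p)}\rangle[p]$ of $X$ is weakly observable, then $G$ is an implicit direct product; indeed the family $(y_m^{(p)})$ has an isomorphic encoder $\Phi$ with $\Phi(\bigoplus_{m,p}\langle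 y_m^{(p)}\rangle)=G\cap\bigoplus_iG_i$. -/

import Mathlib

namespace OrderControllable

universe u v

section Definitions

variable {A : ℕ → Type u} [∀ i, AddCommGroup (A i)]

/-- The direct sum `⨁ A i`, as the subgroup of finitely supported elements of `∏ A i`. -/
def finiteSupport (A : ℕ → Type u) [∀ i, AddCommGroup (A i)] : AddSubgroup (∀ i, A i) where
  carrier := {x | {i | x i ≠ 0}.Finite}
  zero_mem' := by simp
  add_mem' := by
    intro x y hx hy
    refine (Set.Finite.union hx hy).subset fun i hi => ?_
    by_contra h
    simp only [Set.mem_union, Set.mem_ofPred_eq, not_or, not_not] at h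
    exact hi (by simp [h.1, h.2])
  neg_mem' := by
    intro x hx
    simpa using hx

/-- The `p`-primary part of a subgroup: its elements whose order is a power of `p`. -/
def primaryPart {X : Type u} [AddCommGroup X] (H : AddSubgroup X) (p : ℕ) : AddSubgroup X where
  carrier := {x | x ∈ H ∧ ∃ k : ℕ, p ^ k • x = 0}
  zero_mem' := ⟨H.zero_mem, 0, by simp⟩
  add_mem' := by
    rintro x y ⟨hx, k, hk⟩ ⟨hy, l, hl⟩
    refine ⟨H.add_mem hx hy, k + l, ?_⟩
    rw [smul_add, pow_add, mul_smul, mul_smul, hl, smul_comm, hk]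
    simp
  neg_mem' := by
    rintro x ⟨hx, k, hk⟩
    exact ⟨H.neg_mem hx, k, by rw [smul_neg, hk, neg_zero]⟩

/-- The primes `p` such that `G` has a nontrivial `p`-subgroup. -/
def relevantPrimes {X : Type u} [AddCommGroup X] (G : AddSubgroup X) : Set ℕ :=
  {p | p.Prime ∧ ∃ x ∈ primaryPart G p, x ≠ 0}

/-- `G ≤ ∏ A i` is order controllable: for every `i` there is `n` such that each `c ∈ G` agrees on
the coordinates up to `i` with some `c₁ ∈ G` supported in the coordinates up to `n`, whose order
divides the order of the restriction of `c` to the coordinates up to `n`.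
(`addOrderOf` is `0` for infinite order.) -/
def IsOrderControllable (G : AddSubgroup (∀ i, A i)) : Prop :=
  ∀ i : ℕ, ∃ n : ℕ, ∀ c ∈ G, ∃ c₁ ∈ G,
    (∀ j ≤ i, c₁ j = c j) ∧ (∀ j, n < j → c₁ j = 0) ∧
      addOrderOf c₁ ∣ addOrderOf (fun j : Set.Iic n => c j)

/-- The summation map `⨁ₙ ⟨gₙ⟩ → X`, `(xₙ) ↦ ∑ xₙ`. -/
def sumHom {X : Type u} [AddCommGroup X] {ι : Type v} [DecidableEq ι] (g : ι → X) :
    (DirectSum ι fun n => AddSubgroup.zmultiples (g n)) →+ X :=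
  DirectSum.coeAddMonoidHom fun n => AddSubgroup.zmultiples (g n)

variable [∀ i, TopologicalSpace (A i)]

/-- A subgroup of `∏ A i` is weakly observable if it has the same finitely supported elements as
its closure in the product topology. -/
def IsWeaklyObservable (G : AddSubgroup (∀ i, A i)) : Prop :=
  (G : Set (∀ i, A i)) ∩ finiteSupport A = closure (G : Set (∀ i, A i)) ∩ finiteSupport A

/-- `G` is topologically generated by the family `g`: all `g n` are finitely supported elements
of `G`, their cyclic subgroups form a direct sum, and this direct sum is dense in `G`. -/
structure IsTopologicallyGeneratedBy {ι : Type v} [DecidableEq ι]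
    (G : AddSubgroup (∀ i, A i)) (g : ι → ∀ i, A i) : Prop where
  mem : ∀ n, g n ∈ G ⊓ finiteSupport A
  direct : Function.Injective (sumHom g)
  dense : (G : Set (∀ i, A i)) ⊆ closure ((sumHom g).range : Set (∀ i, A i))

/-- `Φ : ∏ ⟨gₙ⟩ ≃ G` is an isomorphic encoder of `G`: `G` is topologically generated by `g`, and
the isomorphism of topological groups `Φ` extends the summation map `⨁ ⟨gₙ⟩ → G`. -/
structure IsIsomorphicEncoder {ι : Type v} [DecidableEq ι]
    (G : AddSubgroup (∀ i, A i)) (g : ι → ∀ i, A i)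
    (Φ : (∀ n, AddSubgroup.zmultiples (g n)) ≃ₜ+ G) : Prop where
  generates : IsTopologicallyGeneratedBy G g
  extends_sum : ∀ x : DirectSum ι fun n => AddSubgroup.zmultiples (g n),
    (Φ (fun n => x n) : ∀ i, A i) = sumHom g x

/-- `G` is weakly rectangular: it has an isomorphic encoder for some sequence `g`. -/
def IsWeaklyRectangular (G : AddSubgroup (∀ i, A i)) : Prop :=
  ∃ g : ℕ → ∀ i, A i, ∃ Φ, IsIsomorphicEncoder G g Φ

/-- The family `g` exhibits `G` as an implicit direct product: it gives an isomorphic encoder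
which carries `⨁ ⟨gₙ⟩` onto the finitely supported elements of `G`. -/
def IsImplicitDirectProductOf {ι : Type v} [DecidableEq ι]
    (G : AddSubgroup (∀ i, A i)) (g : ι → ∀ i, A i) : Prop :=
  (∃ Φ, IsIsomorphicEncoder G g Φ) ∧ (sumHom g).range = G ⊓ finiteSupport A

/-- `G` is an implicit direct product: some sequence `g` exhibits it as one. -/
def IsImplicitDirectProduct (G : AddSubgroup (∀ i, A i)) : Prop :=
  ∃ g : ℕ → ∀ i, A i, IsImplicitDirectProductOf G g

end Definitions

end OrderControllable

namespace OrderControllable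

/-! ### Splitting off one cyclic summand by a character into `ℚ/ℤ` -/

section Splitting

/-! Order controllability is used only through `IsFinitelyApproximable`: elements of `G` are
approximated by finitely supported elements of `G` without increasing their order. This property is
inherited by the summands constructed below, so `G` can be taken apart one cyclic group at a time.

Suppose `L` is closed, approximable and nontrivial in coordinate `i`. Some character `χ` of `A i`
takes values of order dividing `p` on the coordinates of `L`, not all zero. Take the least `k` for
which some `y` in `L` has `p ^ k • y = 0` and `χ (y i) ≠ 0`; approximation makes `y` finitely
supported. By minimality `χ` vanishes on the `p ^ (k - 1)`-torsion of `L`, so compactness and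
divisibility of `ℚ/ℤ` give a character `f` of finitely many coordinates with `p ^ (k - 1) • f x = χ
(x i)` on `L`. Then `f` maps `⟨y⟩` isomorphically onto `f(L)`, and `L = ⟨y⟩ ⊕ (L ∩ ker f)`
(`exists_cyclic_summand`).

Each such step shrinks the image of `L` in the finite group `A i`. Treating every coordinate
infinitely often leaves trivial intersection, and the generators form a product basis
(`exists_isProductBasis`). Summing over it is a continuous isomorphism from the compact group `∏
⟨gₙ⟩` onto `G`. Sorting the basis by primes gives (a) and (b); (c) follows by lowering, one prime at
a time, a multiplier that makes an expansion finite (`IsProductBasis.iSup_eq`). -/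

theorem mem_closure_iff_agree {A : ℕ → Type*} [∀ i, TopologicalSpace (A i)]
    [∀ i, DiscreteTopology (A i)] {S : Set (∀ i, A i)} {x : ∀ i, A i} :
    x ∈ closure S ↔ ∀ n, ∃ s ∈ S, ∀ j ≤ n, s j = x j := by
  rw [mem_closure_iff]
  constructor
  · intro h n
    obtain ⟨s, hs, hsS⟩ := h ((Set.Iic n).pi fun j => {x j})
      (isOpen_set_pi (Set.finite_Iic n) fun _ _ => isOpen_discrete _) (by simp [Set.mem_pi])
    exact ⟨s, hsS, fun j hj => hs j hj⟩
  · intro h o ho hxo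
    obtain ⟨I, u, hu, hsub⟩ := isOpen_pi_iff.1 ho x hxo
    obtain ⟨s, hs, hj⟩ := h (I.sup id)
    refine ⟨s, hsub fun i hi => ?_, hs⟩
    rw [hj i (Finset.le_sup (f := id) hi)]
    exact (hu i hi).2

variable {A : ℕ → Type*} [∀ i, AddCommGroup (A i)]

/-- Restriction to the coordinates up to `n`. -/
def restrict (A : ℕ → Type*) [∀ i, AddCommGroup (A i)] (n : ℕ) :
    (∀ i, A i) →+ (∀ j : Set.Iic n, A j) where
  toFun x j := x j
  map_zero' := rfl
  map_add' _ _ := rfl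

theorem restrict_eq_zero {n : ℕ} {x : ∀ i, A i} : restrict A n x = 0 ↔ ∀ j ≤ n, x j = 0 :=
  ⟨fun h j hj => congrFun h ⟨j, hj⟩, fun h => funext fun j => h j j.2⟩

theorem exists_nsmul_eq_zero_of_mem_finiteSupport [∀ i, Finite (A i)] {x : ∀ i, A i}
    (hx : x ∈ finiteSupport A) : ∃ N : ℕ, 0 < N ∧ N • x = 0 := by
  have hf : {i | x i ≠ 0}.Finite := hx
  refine ⟨∏ i ∈ hf.toFinset, Nat.card (A i), Finset.prod_pos fun i _ => Nat.card_pos, ?_⟩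
  funext i
  by_cases hi : x i = 0
  · simp [hi]
  · obtain ⟨c, hc⟩ := Finset.dvd_prod_of_mem (fun i => Nat.card (A i)) (hf.mem_toFinset.2 hi)
    rw [Pi.smul_apply, hc, mul_comm, mul_smul, card_nsmul_eq_zero', smul_zero, Pi.zero_apply]

/-- Every element of `L` is approximated by finitely supported elements of `L`
which are killed by every integer killing it. -/
def IsFinitelyApproximable (L : AddSubgroup (∀ i, A i)) : Prop :=
  ∀ x ∈ L, ∀ i, ∃ h ∈ L ⊓ finiteSupport A, (∀ j ≤ i, h j = x j) ∧ ∀ n : ℕ, n • x = 0 → n • h = 0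

theorem IsOrderControllable.isFinitelyApproximable {G : AddSubgroup (∀ i, A i)}
    (hG : IsOrderControllable G) : IsFinitelyApproximable G := by
  intro x hx i
  obtain ⟨n, hn⟩ := hG i
  obtain ⟨c, hcG, hc, hsupp, hord⟩ := hn x hx
  refine ⟨c, ⟨hcG, (Set.finite_Iic n).subset fun j hj => ?_⟩, hc, fun k hk => ?_⟩
  · by_contra h
    exact hj (hsupp j (by simpa using h))
  · refine addOrderOf_dvd_iff_nsmul_eq_zero.1 (hord.trans ?_)
    rw [addOrderOf_dvd_iff_nsmul_eq_zero]
    funext j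
    exact congrFun hk j

/-- `χ` descends to the image of `φ`, and `ℚ/ℤ` is divisible, hence injective. -/
theorem exists_character_comp_eq {L M : Type*} [AddCommGroup L] [AddCommGroup M]
    (φ : L →+ M) (χ : L →+ AddCircle (1 : ℚ)) (h : φ.ker ≤ χ.ker) :
    ∃ F : M →+ AddCircle (1 : ℚ), ∀ x, F (φ x) = χ x := by
  obtain ⟨F, hF⟩ := Module.Baer.extension_property_addMonoidHom
    (Module.Baer.of_divisible _) (QuotientAddGroup.kerLift φ)
    (QuotientAddGroup.kerLift_injective φ) (QuotientAddGroup.lift φ.ker χ h)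
  exact ⟨F, fun x => DFunLike.congr_fun hF (x : L ⧸ φ.ker)⟩

/-- The `n`-torsion of `ℚ/ℤ` is cyclic of order `n`, so any element of order `n` generates it;
Bézout supplies the multiplier. -/
theorem mem_zmultiples_of_nsmul_eq_zero {u v : AddCircle (1 : ℚ)} {n : ℕ} (hn : 0 < n)
    (hv : addOrderOf v = n) (hu : n • u = 0) : ∃ c : ℤ, u = c • v := by
  obtain ⟨m, -, rfl⟩ := (AddCircle.nsmul_eq_zero_iff hn).1 hu
  obtain ⟨k, -, hk, rfl⟩ := (AddCircle.addOrderOf_eq_pos_iff hn).1 hv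
  obtain ⟨a, b, hab⟩ : ∃ a b : ℤ, (1 : ℤ) = k * a + n * b :=
    ⟨_, _, by have := Nat.gcd_eq_gcd_ab k n; rw [hk] at this; exact_mod_cast this⟩
  refine ⟨m * a, ?_⟩
  have hab' : (1 : ℚ) = k * a + n * b := by exact_mod_cast hab
  rw [← AddCircle.coe_zsmul, ← sub_eq_zero, ← AddCircle.coe_sub, AddCircle.coe_eq_zero_iff]
  refine ⟨m * b, ?_⟩
  have : (n : ℚ) ≠ 0 := by positivity
  simp only [zsmul_eq_mul]
  push_cast
  field_simp
  linear_combination -(m : ℚ) * hab'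

/-- A character of prime order on a subgroup that is nonzero somewhere in the `i`-th coordinate. -/
theorem exists_character_of_prime_order [∀ i, Finite (A i)] (L : AddSubgroup (∀ i, A i)) (i : ℕ)
    (hi : ∃ x ∈ L, x i ≠ 0) :
    ∃ (p : ℕ) (χ : A i →+ AddCircle (1 : ℚ)), p.Prime ∧ (∃ x ∈ L, χ (x i) ≠ 0) ∧
      ∀ x ∈ L, p • χ (x i) = 0 := by
  obtain ⟨x, hxL, hx⟩ := hi
  obtain ⟨χ, hχ⟩ := CharacterModule.exists_character_apply_ne_zero_of_ne_zero hx
  change A i →+ AddCircle (1 : ℚ) at χ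
  -- If `N` is the least positive integer killing `χ` on the coordinates of `L` and `p ∣ N`, then
  -- `(N / p) • χ` is the required character.
  have hex : ∃ N : ℕ, 0 < N ∧ ∀ x ∈ L, N • χ (x i) = 0 :=
    ⟨Nat.card (A i), Nat.card_pos, fun x _ => by
      rw [← map_nsmul, card_nsmul_eq_zero', map_zero]⟩
  classical
  obtain ⟨hpos, hN⟩ := Nat.find_spec hex
  have hmin := fun m => Nat.find_min (m := m) hex
  set N := Nat.find hex
  have hN1 : N ≠ 1 := by
    intro h
    have := hN x hxL
    rw [h, one_smul] at this
    exact hχ this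
  obtain ⟨p, hp, d, hd⟩ := Nat.exists_prime_and_dvd hN1
  have hd0 : 0 < d := Nat.pos_of_ne_zero fun h => by simp [h] at hd; omega
  refine ⟨p, d • χ, hp, ?_, fun x hx => ?_⟩
  · by_contra hcon
    push Not at hcon
    refine hmin d ?_ ⟨hd0, fun x hx => hcon x hx⟩
    rw [hd]
    exact lt_mul_of_one_lt_left hd0 hp.one_lt
  · rw [AddMonoidHom.smul_apply, ← mul_smul, ← hd]
    exact hN x hx

/-- Divides `χ` by `q` along `L`. By compactness, the vanishing of `q • x` on finitely many
coordinates already forces `χ (x i) = 0`; hence `χ (x i)` depends only on those coordinates of `q •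
x`, and this dependence extends to a character of them. -/
theorem exists_continuous_extension [∀ i, Finite (A i)] [∀ i, TopologicalSpace (A i)]
    [∀ i, DiscreteTopology (A i)] {L : AddSubgroup (∀ i, A i)}
    (hL : IsClosed (L : Set (∀ i, A i))) {i q : ℕ} (χ : A i →+ AddCircle (1 : ℚ))
    (hχ : ∀ x ∈ L, q • x = 0 → χ (x i) = 0) :
    ∃ (n : ℕ) (f : (∀ i, A i) →+ AddCircle (1 : ℚ)),
      (∀ x, (∀ j ≤ n, x j = 0) → f x = 0) ∧ ∀ x ∈ L, q • f x = χ (x i) := by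
  obtain ⟨n, hn⟩ : ∃ n, ∀ x ∈ L, (∀ j ≤ n, q • x j = 0) → χ (x i) = 0 := by
    by_contra! hcon
    -- A point common to these decreasing nonempty compact sets has `q • x = 0` and `χ (x i) ≠ 0`.
    let C : ℕ → Set (∀ i, A i) := fun n =>
      L ∩ ⋂ j ∈ Set.Iic n, (fun x : ∀ i, A i => x j) ⁻¹' {a | q • a = 0} ∩
        (fun x : ∀ i, A i => x i) ⁻¹' {a | χ a ≠ 0}
    have hC : ∀ n, IsClosed (C n) := fun n => by
      refine hL.inter (isClosed_biInter fun j _ => IsClosed.inter ?_ ?_) <;>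
      exact (isClosed_discrete _).preimage (continuous_apply _)
    have hmem : ∀ n x, x ∈ C n ↔ x ∈ L ∧ (∀ j ≤ n, q • x j = 0) ∧ χ (x i) ≠ 0 := fun n x => by
      simp only [C, Set.mem_inter_iff, Set.mem_iInter, Set.mem_preimage, Set.mem_Iic,
        SetLike.mem_coe, Set.mem_ofPred_eq]
      exact ⟨fun h => ⟨h.1, fun j hj => (h.2 j hj).1, (h.2 0 (Nat.zero_le _)).2⟩,
        fun h => ⟨h.1, fun j hj => ⟨h.2.1 j hj, h.2.2⟩⟩⟩
    obtain ⟨x, hx⟩ := IsCompact.nonempty_iInter_of_sequence_nonempty_isCompact_isClosed C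
      (fun n x hx => by
        rw [hmem] at hx ⊢
        exact ⟨hx.1, fun j hj => hx.2.1 j (hj.trans n.le_succ), hx.2.2⟩)
      (fun n => by
        obtain ⟨x, hx⟩ := hcon n
        exact ⟨x, (hmem n x).2 hx⟩)
      (hC 0).isCompact hC
    rw [Set.mem_iInter] at hx
    refine ((hmem 0 x).1 (hx 0)).2.2 (hχ x ((hmem 0 x).1 (hx 0)).1 (funext fun j => ?_))
    exact ((hmem j x).1 (hx j)).2.1 j le_rfl
  obtain ⟨F, hF⟩ := exists_character_comp_eq
    ((restrict A n).comp ((zsmulAddGroupHom (q : ℤ)).comp L.subtype))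
    (χ.comp ((Pi.evalAddMonoidHom A i).comp L.subtype)) (fun x hx => by
      refine hn x x.2 fun j hj => ?_
      have := congrFun (AddMonoidHom.mem_ker.1 hx) ⟨j, hj⟩
      simpa [restrict] using this)
  refine ⟨n, F.comp (restrict A n), fun x hx => ?_, fun x hx => ?_⟩
  · rw [AddMonoidHom.comp_apply, restrict_eq_zero.2 hx, map_zero]
  · rw [← map_nsmul]
    simpa using hF ⟨x, hx⟩

/-- A closed finitely approximable subgroup which is nontrivial in the `i`-th coordinate has a
finitely supported cyclic summand of prime power order whose complement is again closed and
finitely approximable and is smaller in the `i`-th coordinate. -/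
theorem exists_cyclic_summand [∀ i, Finite (A i)] [∀ i, TopologicalSpace (A i)]
    [∀ i, DiscreteTopology (A i)] {L : AddSubgroup (∀ i, A i)}
    (hL : IsClosed (L : Set (∀ i, A i))) (hLa : IsFinitelyApproximable L) {i : ℕ}
    (hi : ∃ x ∈ L, x i ≠ 0) :
    ∃ (y : ∀ i, A i) (L' : AddSubgroup (∀ i, A i)),
      (y ∈ L ⊓ finiteSupport A ∧ ∃ p k : ℕ, p.Prime ∧ p ^ k • y = 0) ∧
      L' ≤ L ∧ IsClosed (L' : Set (∀ i, A i)) ∧ IsFinitelyApproximable L' ∧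
      AddSubgroup.zmultiples y ⊓ L' = ⊥ ∧ L ≤ AddSubgroup.zmultiples y ⊔ L' ∧
      ∀ x ∈ L', x i ≠ y i := by
  obtain ⟨p, χ, hp, ⟨x, hxL, hx⟩, hpχ⟩ := exists_character_of_prime_order L i hi
  -- A finitely supported approximant has finite order; multiplying by the prime-to-`p` part `b`
  -- leaves `p`-power order and does not kill the `χ`-value, which has order `p`.
  have hex : ∃ k, ∃ x ∈ L, p ^ k • x = 0 ∧ χ (x i) ≠ 0 := by
    obtain ⟨h, ⟨hhL, hhf⟩, hagree, -⟩ := hLa x hxL i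
    obtain ⟨N, hN, hNh⟩ := exists_nsmul_eq_zero_of_mem_finiteSupport hhf
    obtain ⟨k, b, hb, rfl⟩ := Nat.exists_eq_pow_mul_and_not_dvd hN.ne' p hp.ne_one
    refine ⟨k, b • h, L.nsmul_mem hhL b, by rw [← mul_smul, hNh], fun h0 => hb ?_⟩
    rw [Pi.smul_apply, map_nsmul, hagree i le_rfl] at h0
    rw [← addOrderOf_eq_prime (hp := ⟨hp⟩) (hpχ x hxL) hx]
    exact addOrderOf_dvd_of_nsmul_eq_zero h0
  classical
  obtain ⟨y₀, hy₀L, hy₀, hχy₀⟩ := Nat.find_spec hex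
  have hmin := fun m => Nat.find_min (m := m) hex
  set k := Nat.find hex
  obtain ⟨y, hy, hyy₀, hyord⟩ := hLa y₀ hy₀L i
  have hpy : p ^ k • y = 0 := hyord _ hy₀
  have hχy : χ (y i) ≠ 0 := by rwa [hyy₀ i le_rfl]
  obtain ⟨e, he⟩ : ∃ e, k = e + 1 := Nat.exists_eq_succ_of_ne_zero fun h => by
    rw [h, pow_zero, one_smul] at hpy
    simp [hpy] at hχy
  -- Minimality of `k = e + 1` says exactly that `χ` kills the `p ^ e`-torsion of `L`.
  obtain ⟨n, f, hfn, hf⟩ := exists_continuous_extension hL (q := p ^ e) χ fun x hxL hx => by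
    by_contra h
    exact hmin e (by omega) ⟨x, hxL, hx, h⟩
  have hkf : ∀ x ∈ L, p ^ k • f x = 0 := fun x hx => by
    rw [he, pow_succ', mul_smul, hf x hx, hpχ x hx]
  have hfy : addOrderOf (f y) = p ^ k := by
    rw [he]
    have : Fact p.Prime := ⟨hp⟩
    refine addOrderOf_eq_prime_pow ?_ (he ▸ hkf y hy.1)
    rwa [hf y hy.1]
  have hagree : ∀ x z, (∀ j ≤ n, x j = z j) → f x = f z := fun x z h => by
    rw [← sub_eq_zero, ← map_sub]
    exact hfn _ fun j hj => by rw [Pi.sub_apply, h j hj, sub_self]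
  refine ⟨y, L ⊓ f.ker, ⟨hy, p, k, hp, hpy⟩, inf_le_left, ?_, ?_, ?_, ?_, ?_⟩
  · refine isClosed_of_closure_subset fun x hx => ?_
    obtain ⟨s, hs, hsx⟩ := mem_closure_iff_agree.1 hx n
    refine AddSubgroup.mem_inf.2 ⟨?_, AddMonoidHom.mem_ker.2 ?_⟩
    · rw [← SetLike.mem_coe, ← hL.closure_eq]
      exact closure_mono (fun z hz => hz.1) hx
    · rw [← hagree s x hsx]
      exact hs.2
  -- Approximating past coordinate `n` preserves the value of `f`, so the approximant stays in the
  -- kernel.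
  · intro x hx j
    obtain ⟨h, hh, hhx, hord⟩ := hLa x hx.1 (max j n)
    refine ⟨h, ⟨⟨hh.1, AddMonoidHom.mem_ker.2 ?_⟩, hh.2⟩,
      fun l hl => hhx l (hl.trans (le_max_left _ _)), hord⟩
    rw [hagree h x fun l hl => hhx l (hl.trans (le_max_right _ _))]
    exact hx.2
  · rw [eq_bot_iff]
    rintro z ⟨hz, -, hzf⟩
    obtain ⟨c, rfl⟩ := AddSubgroup.mem_zmultiples_iff.1 hz
    replace hzf := AddMonoidHom.mem_ker.1 hzf
    rw [map_zsmul, ← addOrderOf_dvd_iff_zsmul_eq_zero, hfy] at hzf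
    obtain ⟨d, rfl⟩ := hzf
    rw [AddSubgroup.mem_bot, mul_comm, mul_smul]
    have : ((p ^ k : ℕ) : ℤ) • y = 0 := by rw [natCast_zsmul, hpy]
    rw [this, smul_zero]
  · intro x hx
    obtain ⟨c, hc⟩ := mem_zmultiples_of_nsmul_eq_zero (pow_pos hp.pos k) hfy (hkf x hx)
    rw [← add_sub_cancel (c • y) x]
    refine AddSubgroup.add_mem_sup (AddSubgroup.zsmul_mem_zmultiples y c)
      ⟨L.sub_mem hx (L.zsmul_mem hy.1 c), AddMonoidHom.mem_ker.2 ?_⟩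
    rw [map_sub, map_zsmul, hc, sub_self]
  · intro x hx hxy
    refine hχy ?_
    rw [← hxy, ← hf x hx.1, AddMonoidHom.mem_ker.1 hx.2, smul_zero]

end Splitting

/-! ### Product bases and infinite sums -/

section Basis

variable {A : ℕ → Type*} [∀ i, AddCommGroup (A i)] {ι : Type*}

/-- Coordinatewise sum of a family which is finitely supported in each coordinate. -/
noncomputable def limitSum (x : ι → ∀ i, A i) : ∀ i, A i := fun i => ∑ᶠ n, x n i

/-- Each coordinate is nonzero on finitely many members of the family only. -/
def IsLocallyFinite (g : ι → ∀ i, A i) : Prop := ∀ i, {n | g n i ≠ 0}.Finite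

theorem IsLocallyFinite.of_mem_zmultiples {g x : ι → ∀ i, A i} (hg : IsLocallyFinite g)
    (hx : ∀ n, x n ∈ AddSubgroup.zmultiples (g n)) : IsLocallyFinite x := fun i =>
  (hg i).subset fun n hn h0 => hn <| by
    obtain ⟨c, hc⟩ := AddSubgroup.mem_zmultiples_iff.1 (hx n)
    rw [← hc, Pi.smul_apply, h0, smul_zero]

theorem limitSum_add {x z : ι → ∀ i, A i} (hx : IsLocallyFinite x) (hz : IsLocallyFinite z) :
    limitSum (fun n => x n + z n) = limitSum x + limitSum z :=
  funext fun i => finsum_add_distrib (hx i) (hz i)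

theorem limitSum_zero : limitSum (fun _ : ι => (0 : ∀ i, A i)) = 0 := by
  funext i
  simp [limitSum]

theorem limitSum_nsmul (N : ℕ) {x : ι → ∀ i, A i} (hx : IsLocallyFinite x) :
    limitSum (fun n => N • x n) = N • limitSum x := by
  induction N with
  | zero => simp [limitSum_zero]
  | succ N ih =>
    have hN : IsLocallyFinite fun n => N • x n :=
      hx.of_mem_zmultiples fun n => AddSubgroup.nsmul_mem_zmultiples _ _
    simp only [succ_nsmul]
    rw [limitSum_add hN hx, ih]

theorem limitSum_eq_single {x : ι → ∀ i, A i} (n : ι) (hx : ∀ m, m ≠ n → x m = 0) :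
    limitSum x = x n :=
  funext fun i => finsum_eq_single _ n fun m hm => by rw [hx m hm, Pi.zero_apply]

theorem limitSum_eq_sum {x : ι → ∀ i, A i} {s : Finset ι} (hs : ∀ n, x n ≠ 0 → n ∈ s) :
    limitSum x = ∑ n ∈ s, x n := by
  funext i
  rw [Finset.sum_apply]
  refine finsum_eq_sum_of_support_subset _ fun n hn => hs n fun h => hn ?_
  simp only [h, Pi.zero_apply]

theorem limitSum_agree {x : ι → ∀ i, A i} (hx : IsLocallyFinite x) {H : AddSubgroup (∀ i, A i)}
    (hxH : ∀ n, x n ∈ H) (i : ℕ) : ∃ s ∈ H, ∀ j ≤ i, s j = limitSum x j := by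
  classical
  have hfin : (⋃ j ∈ Set.Iic i, {n | x n j ≠ 0}).Finite :=
    (Set.finite_Iic i).biUnion fun j _ => hx j
  refine ⟨∑ n ∈ hfin.toFinset, x n, H.sum_mem fun n _ => hxH n, fun j hj => ?_⟩
  rw [Finset.sum_apply]
  refine (finsum_eq_sum_of_support_subset _ fun n hn => ?_).symm
  rw [Finset.mem_coe, hfin.mem_toFinset]
  exact Set.mem_biUnion hj hn

theorem range_sumHom [DecidableEq ι] (g : ι → ∀ i, A i) :
    (sumHom g).range = ⨆ n, AddSubgroup.zmultiples (g n) := by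
  refine le_antisymm ?_ (iSup_le fun n z hz => ?_)
  · rintro _ ⟨x, rfl⟩
    induction x using DirectSum.induction_on with
    | zero => rw [map_zero]; exact AddSubgroup.zero_mem _
    | of n z =>
      rw [sumHom, DirectSum.coeAddMonoidHom_of]
      exact AddSubgroup.mem_iSup_of_mem n z.2
    | add x z hx hz => rw [map_add]; exact AddSubgroup.add_mem _ hx hz
  · exact ⟨DirectSum.of (fun n => AddSubgroup.zmultiples (g n)) n ⟨z, hz⟩,
      DirectSum.coeAddMonoidHom_of _ _ _⟩

/-- A locally finite family of finitely supported elements of `G` whose finite sums of multiples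
approximate `G`, and whose infinite sums of multiples vanish only trivially. -/
structure IsProductBasis (G : AddSubgroup (∀ i, A i)) (g : ι → ∀ i, A i) : Prop where
  mem : ∀ n, g n ∈ G ⊓ finiteSupport A
  locallyFinite : IsLocallyFinite g
  dense : ∀ x ∈ G, ∀ i, ∃ s ∈ ⨆ n, AddSubgroup.zmultiples (g n), ∀ j ≤ i, s j = x j
  independent : ∀ x : ι → ∀ i, A i, (∀ n, x n ∈ AddSubgroup.zmultiples (g n)) →
    limitSum x = 0 → ∀ n, x n = 0

/-- The map `∏ ⟨gₙ⟩ → ∏ A i` which sums the components. -/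
noncomputable def limitSumHom (g : ι → ∀ i, A i) (hg : IsLocallyFinite g) :
    (∀ n, AddSubgroup.zmultiples (g n)) →+ ∀ i, A i where
  toFun x := limitSum fun n => (x n : ∀ i, A i)
  map_zero' := limitSum_zero
  map_add' x z := limitSum_add (hg.of_mem_zmultiples fun n => (x n).2)
    (hg.of_mem_zmultiples fun n => (z n).2)

theorem limitSumHom_coe [DecidableEq ι] {g : ι → ∀ i, A i} (hg : IsLocallyFinite g)
    (x : DirectSum ι fun n => AddSubgroup.zmultiples (g n)) :
    limitSumHom g hg (fun n => x n) = sumHom g x := by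
  induction x using DirectSum.induction_on with
  | zero => rw [map_zero]; exact map_zero (limitSumHom g hg)
  | of n z =>
    rw [sumHom, DirectSum.coeAddMonoidHom_of]
    refine (limitSum_eq_single n fun m hm => ?_).trans ?_
    · rw [DirectSum.coe_of_apply, if_neg hm.symm]; rfl
    · rw [DirectSum.coe_of_apply, if_pos rfl]
  | add x z hx hz =>
    rw [map_add, ← hx, ← hz]
    exact map_add (limitSumHom g hg) (fun n => x n) fun n => z n

theorem IsProductBasis.injective {G : AddSubgroup (∀ i, A i)} {g : ι → ∀ i, A i}
    (hg : IsProductBasis G g) : Function.Injective (limitSumHom g hg.locallyFinite) := by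
  rw [injective_iff_map_eq_zero]
  intro x hx
  funext n
  exact Subtype.ext (hg.independent (fun n => x n) (fun n => (x n).2) hx n)

theorem IsProductBasis.iSup_le {G : AddSubgroup (∀ i, A i)} {g : ι → ∀ i, A i}
    (hg : IsProductBasis G g) : ⨆ n, AddSubgroup.zmultiples (g n) ≤ G ⊓ finiteSupport A :=
  _root_.iSup_le fun n => AddSubgroup.zmultiples_le_of_mem (hg.mem n)

/-- A product basis pulled back along a map that only adds or removes zero members. -/
theorem IsProductBasis.comap {κ : Type*} {G : AddSubgroup (∀ i, A i)} {g : ι → ∀ i, A i}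
    (hg : IsProductBasis G g) {g' : κ → ∀ i, A i} (q : κ → ι)
    (hq : Set.InjOn q {n | g' n ≠ 0}) (hgq : ∀ n, g' n ≠ 0 → g' n = g (q n))
    (hsurj : ∀ n, g n ≠ 0 → ∃ m, g' m ≠ 0 ∧ q m = n) : IsProductBasis G g' where
  mem n := by
    by_cases h : g' n = 0
    · rw [h]; exact AddSubgroup.zero_mem _
    · rw [hgq n h]; exact hg.mem _
  locallyFinite i := by
    have hsub : {n | g' n i ≠ 0} ⊆ {n | g' n ≠ 0} := fun n hn h => hn (by rw [h, Pi.zero_apply])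
    refine Set.Finite.of_finite_image ((hg.locallyFinite i).subset ?_) (hq.mono hsub)
    rintro _ ⟨n, hn, rfl⟩
    rw [Set.mem_ofPred_eq, ← hgq n (hsub hn)]
    exact hn
  dense x hx i := by
    obtain ⟨s, hs, hsx⟩ := hg.dense x hx i
    have hle : ⨆ n, AddSubgroup.zmultiples (g n) ≤ ⨆ m, AddSubgroup.zmultiples (g' m) := by
      refine _root_.iSup_le fun n => ?_
      by_cases h : g n = 0
      · rw [h, AddSubgroup.zmultiples_zero_eq_bot]; exact bot_le
      · obtain ⟨m, hm, rfl⟩ := hsurj n h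
        rw [← hgq m hm]
        exact le_iSup (fun m => AddSubgroup.zmultiples (g' m)) m
    exact ⟨s, hle hs, hsx⟩
  independent x hx hx0 := by
    classical
    have hzero : ∀ n, g' n = 0 → x n = 0 := fun n hn => by
      have := hx n
      rwa [hn, AddSubgroup.zmultiples_zero_eq_bot, AddSubgroup.mem_bot] at this
    -- The family `x` pushed forward along `q`, so that independence of `g` applies.
    let z : ι → ∀ i, A i := fun n => if h : ∃ m, g' m ≠ 0 ∧ q m = n then x h.choose else 0
    have hzq : ∀ m, g' m ≠ 0 → z (q m) = x m := fun m hm => by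
      have h : ∃ m', g' m' ≠ 0 ∧ q m' = q m := ⟨m, hm, rfl⟩
      simp only [z, dif_pos h]
      rw [hq h.choose_spec.1 hm h.choose_spec.2]
    have hzmem : ∀ n, z n ∈ AddSubgroup.zmultiples (g n) := fun n => by
      by_cases h : ∃ m, g' m ≠ 0 ∧ q m = n
      · obtain ⟨m, hm, rfl⟩ := h
        rw [hzq m hm, ← hgq m hm]
        exact hx m
      · simp only [z, dif_neg h]
        exact AddSubgroup.zero_mem _
    have hz : ∀ n, z n = 0 := hg.independent z hzmem <| by
      rw [← hx0]
      funext i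
      have h1 : ∑ᶠ n, z n i = ∑ᶠ (n) (_ : n ∈ q '' {m | g' m ≠ 0}), z n i := by
        refine finsum_congr fun n => ?_
        by_cases h : n ∈ q '' {m | g' m ≠ 0}
        · rw [finsum_eq_if, if_pos h]
        · rw [finsum_eq_if, if_neg h]
          have : z n = 0 := dif_neg h
          rw [this, Pi.zero_apply]
      change ∑ᶠ n, z n i = ∑ᶠ n, x n i
      rw [h1, finsum_mem_image hq]
      refine finsum_congr fun m => ?_
      rw [finsum_eq_if]
      split_ifs with hm
      · rw [hzq m hm]
      · rw [hzero m (not_not.1 hm), Pi.zero_apply]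
    intro n
    by_cases h : g' n = 0
    · exact hzero n h
    · rw [← hzq n h, hz]

variable [∀ i, TopologicalSpace (A i)]

theorem IsProductBasis.compactSpace [∀ i, Finite (A i)] {G : AddSubgroup (∀ i, A i)}
    {g : ι → ∀ i, A i}
    (hg : IsProductBasis G g) : CompactSpace (∀ n, AddSubgroup.zmultiples (g n)) := by
  have (n : ι) : Finite (AddSubgroup.zmultiples (g n)) := by
    obtain ⟨N, hN, h⟩ := exists_nsmul_eq_zero_of_mem_finiteSupport (hg.mem n).2
    exact finite_zmultiples.2 <| isOfFinAddOrder_iff_nsmul_eq_zero.2 ⟨N, hN, h⟩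
  infer_instance

variable [∀ i, DiscreteTopology (A i)]

theorem limitSum_mem_closure {x : ι → ∀ i, A i} (hx : IsLocallyFinite x)
    {H : AddSubgroup (∀ i, A i)} (hxH : ∀ n, x n ∈ H) :
    limitSum x ∈ closure (H : Set (∀ i, A i)) :=
  mem_closure_iff_agree.2 (limitSum_agree hx hxH)

theorem continuous_limitSumHom {g : ι → ∀ i, A i} (hg : IsLocallyFinite g) :
    Continuous (limitSumHom g hg) := by
  refine continuous_pi fun i => ?_
  have h : ∀ x : ∀ n, AddSubgroup.zmultiples (g n), limitSumHom g hg x i =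
      ∑ n ∈ (hg i).toFinset, (x n : ∀ i, A i) i := fun x =>
    finsum_eq_sum_of_support_subset _ fun n hn => by
      rw [Finset.mem_coe, Set.Finite.mem_toFinset]
      intro h0
      obtain ⟨c, hc⟩ := AddSubgroup.mem_zmultiples_iff.1 (x n).2
      refine hn ?_
      change (x n : ∀ i, A i) i = 0
      rw [← hc, Pi.smul_apply, h0, smul_zero]
  simp_rw [h]
  exact continuous_finsetSum _ fun n _ =>
    (continuous_apply i).comp (continuous_subtype_val.comp (continuous_apply n))

theorem IsProductBasis.isTopologicallyGeneratedBy [DecidableEq ι] {G : AddSubgroup (∀ i, A i)}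
    {g : ι → ∀ i, A i} (hg : IsProductBasis G g) : IsTopologicallyGeneratedBy G g where
  mem := hg.mem
  direct := fun x z h => by
    rw [← limitSumHom_coe hg.locallyFinite, ← limitSumHom_coe hg.locallyFinite] at h
    exact DFinsupp.ext fun n => congrFun (hg.injective h) n
  dense := fun x hx => by
    rw [range_sumHom]
    exact mem_closure_iff_agree.2 (hg.dense x hx)

variable [∀ i, Finite (A i)]

/-- The range is compact, hence closed, and it contains the finite sums, which approximate `G`. -/
theorem IsProductBasis.range_limitSumHom {G : AddSubgroup (∀ i, A i)}
    (hG : IsClosed (G : Set (∀ i, A i))) {g : ι → ∀ i, A i} (hg : IsProductBasis G g) :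
    (limitSumHom g hg.locallyFinite).range = G := by
  classical
  refine le_antisymm ?_ fun x hx => ?_
  · rintro _ ⟨x, rfl⟩
    rw [← SetLike.mem_coe, ← hG.closure_eq]
    exact limitSum_mem_closure (hg.locallyFinite.of_mem_zmultiples fun n => (x n).2) fun n =>
      AddSubgroup.zmultiples_le_of_mem (hg.mem n).1 (x n).2
  · have := hg.compactSpace
    have hclosed : IsClosed (Set.range (limitSumHom g hg.locallyFinite)) :=
      (isCompact_range (continuous_limitSumHom hg.locallyFinite)).isClosed
    change x ∈ Set.range (limitSumHom g hg.locallyFinite)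
    rw [← hclosed.closure_eq]
    refine mem_closure_iff_agree.2 fun i => ?_
    obtain ⟨s, hs, hsx⟩ := hg.dense x hx i
    rw [← range_sumHom] at hs
    obtain ⟨z, rfl⟩ := hs
    exact ⟨_, ⟨fun n => z n, limitSumHom_coe hg.locallyFinite z⟩, hsx⟩

theorem IsProductBasis.exists_isIsomorphicEncoder [DecidableEq ι] {G : AddSubgroup (∀ i, A i)}
    (hG : IsClosed (G : Set (∀ i, A i))) {g : ι → ∀ i, A i} (hg : IsProductBasis G g) :
    ∃ Φ, IsIsomorphicEncoder G g Φ := by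
  have := hg.compactSpace
  have hmem : ∀ x, limitSumHom g hg.locallyFinite x ∈ G := fun x =>
    (hg.range_limitSumHom hG).le ⟨x, rfl⟩
  let φ := (limitSumHom g hg.locallyFinite).codRestrict G hmem
  have hφ : Continuous φ := (continuous_limitSumHom hg.locallyFinite).subtype_mk hmem
  have hbij : Function.Bijective φ := by
    refine ⟨fun x z h => hg.injective (congrArg Subtype.val h), fun x => ?_⟩
    obtain ⟨z, hz⟩ := (hg.range_limitSumHom hG).ge x.2
    exact ⟨z, Subtype.ext hz⟩
  let e := AddEquiv.ofBijective φ hbij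
  have he : Continuous e.toEquiv := hφ
  exact ⟨{ e with
      continuous_toFun := he
      continuous_invFun := he.continuous_symm_of_equiv_compact_to_t2 },
    hg.isTopologicallyGeneratedBy, limitSumHom_coe hg.locallyFinite⟩

/-- If the closures of the sums of the `p`-torsion parts of the cyclic groups `⟨gₙ⟩` have no further
finitely supported elements, then neither has `G` over `⨁ ⟨gₙ⟩`. -/
theorem IsProductBasis.iSup_eq {G : AddSubgroup (∀ i, A i)}
    (hG : IsClosed (G : Set (∀ i, A i))) {g : ι → ∀ i, A i} (hg : IsProductBasis G g)
    (hobs : ∀ p : ℕ, p.Prime → IsWeaklyObservable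
      (⨆ n, AddSubgroup.zmultiples (g n) ⊓ AddSubgroup.torsionBy (∀ i, A i) (p : ℤ))) :
    ⨆ n, AddSubgroup.zmultiples (g n) = G ⊓ finiteSupport A := by
  classical
  refine le_antisymm hg.iSup_le fun x hx => ?_
  obtain ⟨z', hz'⟩ := (hg.range_limitSumHom hG).ge hx.1
  obtain ⟨z, hzg, rfl⟩ : ∃ z : ι → ∀ i, A i, (∀ n, z n ∈ AddSubgroup.zmultiples (g n)) ∧
    limitSum z = x := ⟨fun n => z' n, fun n => (z' n).2, hz'⟩
  have hmul : ∀ N n, N • z n ∈ AddSubgroup.zmultiples (g n) := fun N n =>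
    AddSubgroup.nsmul_mem _ (hzg n) N
  have hfinsum : ∀ u : ι → ∀ i, A i, (∀ n, u n ∈ AddSubgroup.zmultiples (g n)) →
      {n | u n ≠ 0}.Finite → limitSum u ∈ ⨆ n, AddSubgroup.zmultiples (g n) := fun u hu hfin => by
    rw [limitSum_eq_sum (s := hfin.toFinset) fun n hn => hfin.mem_toFinset.2 hn]
    exact AddSubgroup.sum_mem _ fun n _ => AddSubgroup.mem_iSup_of_mem n (hu n)
  -- An integer killing `x` kills every `z n` by independence. The least `N` leaving finitely many
  -- nonzero terms will be shown to be `1`.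
  have hex : ∃ N : ℕ, 0 < N ∧ {n | N • z n ≠ 0}.Finite := by
    obtain ⟨N, hN, hNz⟩ := exists_nsmul_eq_zero_of_mem_finiteSupport hx.2
    refine ⟨N, hN, ?_⟩
    rw [← limitSum_nsmul N (hg.locallyFinite.of_mem_zmultiples hzg)] at hNz
    have := hg.independent _ (hmul N) hNz
    simp [this]
  obtain ⟨hpos, hfin⟩ := Nat.find_spec hex
  have hmin := fun m => Nat.find_min (m := m) hex
  set N := Nat.find hex
  by_cases hN1 : N = 1
  · refine hfinsum z hzg ?_
    simpa [hN1] using hfin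
  exfalso
  obtain ⟨p, hp, d, hd⟩ := Nat.exists_prime_and_dvd hN1
  have hd0 : 0 < d := Nat.pos_of_ne_zero fun h => by simp [h] at hd; omega
  refine hmin d (by rw [hd]; exact lt_mul_of_one_lt_left hd0 hp.one_lt) ⟨hd0, ?_⟩
  -- With `N = p * d`, split `d • z` into `w`, whose terms are killed by `p`, and the finite
  -- remainder `v`. Then `limitSum w` is finitely supported, and weak observability applies to it.
  let w : ι → ∀ i, A i := fun n => if N • z n = 0 then d • z n else 0
  let v : ι → ∀ i, A i := fun n => if N • z n = 0 then 0 else d • z n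
  have hwg : ∀ n, w n ∈ AddSubgroup.zmultiples (g n) := fun n => by
    simp only [w]; split_ifs
    exacts [hmul d n, AddSubgroup.zero_mem _]
  have hvg : ∀ n, v n ∈ AddSubgroup.zmultiples (g n) := fun n => by
    simp only [v]; split_ifs
    exacts [AddSubgroup.zero_mem _, hmul d n]
  have hvfin : {n | v n ≠ 0}.Finite := hfin.subset fun n hn h => hn (if_pos h)
  have hwf := hg.locallyFinite.of_mem_zmultiples hwg
  have hsum : limitSum w + limitSum v = d • limitSum z := by
    rw [← limitSum_add hwf (hg.locallyFinite.of_mem_zmultiples hvg),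
      ← limitSum_nsmul d (hg.locallyFinite.of_mem_zmultiples hzg)]
    congr 1
    funext n
    simp only [w, v]
    split_ifs <;> simp
  have hws : limitSum w ∈ finiteSupport A := by
    rw [eq_sub_of_add_eq hsum]
    exact AddSubgroup.sub_mem _ (AddSubgroup.nsmul_mem _ hx.2 d)
      (hg.iSup_le (hfinsum v hvg hvfin)).2
  have hwp : ∀ n, w n ∈ ⨆ n, AddSubgroup.zmultiples (g n) ⊓
      AddSubgroup.torsionBy (∀ i, A i) (p : ℤ) := fun n => by
    refine AddSubgroup.mem_iSup_of_mem n ⟨hwg n, ?_⟩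
    change (p : ℤ) • w n = 0
    rw [natCast_zsmul]
    simp only [w]
    split_ifs with h
    · rw [← mul_smul, ← hd, h]
    · exact smul_zero _
  have hwmem : limitSum w ∈ ⨆ n, AddSubgroup.zmultiples (g n) := by
    have h := (hobs p hp).ge ⟨limitSum_mem_closure hwf hwp, hws⟩
    have hle : ⨆ n, AddSubgroup.zmultiples (g n) ⊓ AddSubgroup.torsionBy (∀ i, A i) (p : ℤ) ≤
        ⨆ n, AddSubgroup.zmultiples (g n) := iSup_mono fun n => inf_le_left
    exact hle h.1
  rw [← range_sumHom] at hwmem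
  obtain ⟨u, hu⟩ := hwmem
  rw [← limitSumHom_coe hg.locallyFinite] at hu
  -- Uniqueness of expansions: `w` is the finite family `u`, so `d • z` has finitely many nonzero
  -- terms, against the minimality of `N`.
  have huw : (fun n => u n) = fun n => (⟨w n, hwg n⟩ : AddSubgroup.zmultiples (g n)) :=
    hg.injective hu
  refine (hfin.union (DFinsupp.finite_support u)).subset fun n hn => ?_
  by_contra hcon
  rw [Set.mem_union, not_or] at hcon
  have hNz : N • z n = 0 := not_not.1 hcon.1
  have hun : u n = 0 := not_not.1 hcon.2
  have := congrArg Subtype.val (congrFun huw n)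
  simp only [hun, w, if_pos hNz] at this
  exact hn this.symm

end Basis

/-! ### Exhausting the group by cyclic summands -/

section Decomposition

variable {A : ℕ → Type*} [∀ i, AddCommGroup (A i)] [∀ i, Finite (A i)]
  [∀ i, TopologicalSpace (A i)] [∀ i, DiscreteTopology (A i)]

/-- A closed finitely approximable subgroup has a decreasing sequence of closed subgroups with
trivial intersection in which each term splits off a finitely supported cyclic group of prime
power order from its predecessor. -/
theorem exists_summand_sequence {G : AddSubgroup (∀ i, A i)}
    (hG : IsClosed (G : Set (∀ i, A i))) (hGa : IsFinitelyApproximable G) :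
    ∃ (g : ℕ → ∀ i, A i) (L : ℕ → AddSubgroup (∀ i, A i)), L 0 = G ∧ Antitone L ∧
      (∀ m, IsClosed (L m : Set (∀ i, A i))) ∧
      (∀ m, g m ∈ L m ⊓ finiteSupport A ∧ ∃ p k : ℕ, p.Prime ∧ p ^ k • g m = 0) ∧
      (∀ m, AddSubgroup.zmultiples (g m) ⊓ L (m + 1) = ⊥) ∧
      (∀ m, L m ≤ AddSubgroup.zmultiples (g m) ⊔ L (m + 1)) ∧
      ∀ i, ∃ M, ∀ x ∈ L M, x i = 0 := by
  let S := {L : AddSubgroup (∀ i, A i) //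
    IsClosed (L : Set (∀ i, A i)) ∧ IsFinitelyApproximable L}
  have step : ∀ (L : S) (i : ℕ), ∃ (y : ∀ i, A i) (L' : S),
      (y ∈ L.1 ⊓ finiteSupport A ∧ ∃ p k : ℕ, p.Prime ∧ p ^ k • y = 0) ∧ L'.1 ≤ L.1 ∧
      AddSubgroup.zmultiples y ⊓ L'.1 = ⊥ ∧ L.1 ≤ AddSubgroup.zmultiples y ⊔ L'.1 ∧
      ((∃ x ∈ L.1, x i ≠ 0) → ∀ x ∈ L'.1, x i ≠ y i) := by
    intro L i
    by_cases hi : ∃ x ∈ L.1, x i ≠ 0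
    · obtain ⟨y, L', hy, hle, hcl, happ, hinf, hsup, hne⟩ :=
        exists_cyclic_summand L.2.1 L.2.2 hi
      exact ⟨y, ⟨L', hcl, happ⟩, hy, hle, hinf, hsup, fun _ => hne⟩
    · refine ⟨0, L, ⟨AddSubgroup.zero_mem _, 2, 0, Nat.prime_two, smul_zero _⟩, le_rfl, ?_, ?_,
        fun h => absurd h hi⟩
      · rw [AddSubgroup.zmultiples_zero_eq_bot, bot_inf_eq]
      · exact le_sup_right
  choose y next hy hle hinf hsup hne using step
  -- Stage `m` treats coordinate `m.unpair.1`, so each coordinate recurs infinitely often.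
  let L : ℕ → S := fun m => Nat.rec ⟨G, hG, hGa⟩ (fun m s => next s m.unpair.1) m
  have hL : ∀ m, L (m + 1) = next (L m) m.unpair.1 := fun _ => rfl
  have hanti : Antitone fun m => (L m).1 := antitone_nat_of_succ_le fun m => hle _ _
  refine ⟨fun m => y (L m) m.unpair.1, fun m => (L m).1, rfl, hanti, fun m => (L m).2.1,
    fun m => hy _ _, fun m => hinf _ _, fun m => hsup _ _, fun i => ?_⟩
  -- The images in the finite group `A i` stabilize from `M` on. Stage `Nat.pair i M ≥ M` treats
  -- coordinate `i`; were the image nonzero, `y` would drop out of it, contradicting stability.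
  obtain ⟨M, hM⟩ := WellFoundedLT.antitone_chain_condition
    (f := fun m => (L m).1.map (Pi.evalAddMonoidHom A i)) fun m n h =>
      AddSubgroup.map_mono (hanti h)
  refine ⟨Nat.pair i M, ?_⟩
  by_contra! hcon
  have hne' := hne (L (Nat.pair i M)) i hcon
  have hmem : y (L (Nat.pair i M)) i i ∈ (L M).1.map (Pi.evalAddMonoidHom A i) :=
    ⟨_, hanti (Nat.right_le_pair i M) (hy (L (Nat.pair i M)) i).1.1, rfl⟩
  rw [hM (Nat.pair i M + 1) ((Nat.right_le_pair i M).trans (Nat.le_succ _)), hL,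
    Nat.unpair_pair] at hmem
  obtain ⟨x, hx, hxy⟩ := hmem
  exact hne' x hx hxy

/-- A closed finitely approximable subgroup has a product basis of elements of prime power order,
whatever its exponent: cyclic summands are split off one at a time. -/
theorem exists_isProductBasis {G : AddSubgroup (∀ i, A i)}
    (hG : IsClosed (G : Set (∀ i, A i))) (hGa : IsFinitelyApproximable G) :
    ∃ g : ℕ → ∀ i, A i, IsProductBasis G g ∧ ∀ m, ∃ p k : ℕ, p.Prime ∧ p ^ k • g m = 0 := by
  obtain ⟨g, L, hL0, hanti, hcl, hg, hinf, hsup, hlim⟩ := exists_summand_sequence hG hGa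
  have hlf : IsLocallyFinite g := fun i => by
    obtain ⟨M, hM⟩ := hlim i
    refine (Set.finite_Iio M).subset fun n hn => ?_
    by_contra h
    exact hn (hM _ (hanti (not_lt.1 h) (hg n).1.1))
  refine ⟨g, ⟨fun m => ⟨hL0 ▸ hanti (Nat.zero_le m) (hg m).1.1, (hg m).1.2⟩, hlf, ?_, ?_⟩,
    fun m => (hg m).2⟩
  · intro x hx i
    choose M hM using hlim
    -- The remainder in `L m` vanishes up to coordinate `i` once `m` exceeds the thresholds `M j`,
    -- `j ≤ i`.
    have hG' : ∀ m, G ≤ (⨆ n, AddSubgroup.zmultiples (g n)) ⊔ L m := fun m => by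
      induction m with
      | zero => rw [hL0]; exact le_sup_right
      | succ m ih =>
        refine ih.trans (sup_le le_sup_left ((hsup m).trans (sup_le_sup_right ?_ _)))
        exact le_iSup (fun n => AddSubgroup.zmultiples (g n)) m
    obtain ⟨s, hs, r, hr, rfl⟩ := AddSubgroup.mem_sup.1 (hG' ((Finset.Iic i).sup M) hx)
    refine ⟨s, hs, fun j hj => ?_⟩
    rw [Pi.add_apply, hM j r (hanti (Finset.le_sup (Finset.mem_Iic.2 hj)) hr), add_zero]
  · intro x hx hx0 n
    have hxL : ∀ m, x m ∈ L m := fun m => AddSubgroup.zmultiples_le_of_mem (hg m).1.1 (hx m)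
    induction n using Nat.strong_induction_on with
    | _ n ih =>
      have hxf := hlf.of_mem_zmultiples hx
      -- Removing the `n`-th term leaves terms that vanish before `n` and lie in the closed group `L
      -- (n + 1)` after it. Hence `x n` is minus an element of `L (n + 1)`, which meets `⟨g n⟩`
      -- trivially.
      let z : ℕ → ∀ i, A i := fun m => if m = n then 0 else x m
      let u : ℕ → ∀ i, A i := fun m => if m = n then x n else 0
      have hzL : ∀ m, z m ∈ L (n + 1) := fun m => by
        rcases lt_trichotomy m n with h | h | h
        · simp only [z, if_neg h.ne, ih m h]; exact AddSubgroup.zero_mem _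
        · simp only [z, if_pos h]; exact AddSubgroup.zero_mem _
        · simp only [z, if_neg h.ne']; exact hanti h (hxL m)
      have hzf : IsLocallyFinite z := hlf.of_mem_zmultiples fun m => by
        simp only [z]; split_ifs
        exacts [AddSubgroup.zero_mem _, hx m]
      have huf : IsLocallyFinite u := hlf.of_mem_zmultiples fun m => by
        simp only [u]; split_ifs with h
        exacts [h ▸ hx n, AddSubgroup.zero_mem _]
      have hz : limitSum z ∈ L (n + 1) := by
        rw [← SetLike.mem_coe, ← (hcl (n + 1)).closure_eq]
        exact limitSum_mem_closure hzf hzL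
      have hu : limitSum u = x n := by
        rw [limitSum_eq_single n fun m hm => if_neg hm]
        exact if_pos rfl
      have hsum : x n + limitSum z = 0 := by
        rw [← hu, ← limitSum_add huf hzf, ← hx0]
        congr 1
        funext m
        simp only [u, z]
        split_ifs with h
        · rw [h, add_zero]
        · rw [zero_add]
      have hmem : x n ∈ AddSubgroup.zmultiples (g n) ⊓ L (n + 1) := by
        refine ⟨hx n, ?_⟩
        rw [eq_neg_of_add_eq_zero_left hsum]
        exact AddSubgroup.neg_mem _ hz
      rwa [hinf n, AddSubgroup.mem_bot] at hmem

end Decomposition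

end OrderControllable

/-! ### Sorting the basis by primes -/

theorem theoremA {A : ℕ → Type*} [∀ i, AddCommGroup (A i)] [∀ i, Finite (A i)]
    [∀ i, TopologicalSpace (A i)] [∀ i, DiscreteTopology (A i)]
    (G : AddSubgroup (∀ i, A i)) (hclosed : IsClosed (G : Set (∀ i, A i)))
    (hG : OrderControllable.IsOrderControllable G) :
    ∃ y : OrderControllable.relevantPrimes G → ℕ → ∀ i, A i,
      -- (a)
      (OrderControllable.IsTopologicallyGeneratedBy G (Function.uncurry y) ∧
        ∀ (p : OrderControllable.relevantPrimes G) (m : ℕ), y p m ∈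
          OrderControllable.primaryPart (G ⊓ OrderControllable.finiteSupport A) (p : ℕ)) ∧
      -- (b)
      (AddMonoid.ExponentExists G →
        (∃ Φ, OrderControllable.IsIsomorphicEncoder G (Function.uncurry y) Φ) ∧
          OrderControllable.IsWeaklyRectangular G) ∧
      -- (c)
      ((∀ p, OrderControllable.IsWeaklyObservable
          (⨆ m, AddSubgroup.zmultiples (y p m) ⊓ AddSubgroup.torsionBy (∀ i, A i) ((p : ℕ) : ℤ))) →
        OrderControllable.IsImplicitDirectProductOf G (Function.uncurry y) ∧
          OrderControllable.IsImplicitDirectProduct G) := by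
  classical
  obtain ⟨g, hg, hgp⟩ := OrderControllable.exists_isProductBasis hclosed hG.isFinitelyApproximable
  -- Each nonzero `g m` belongs to exactly one prime and keeps its index `m` there; the other
  -- entries are padded with zeros.
  let y : OrderControllable.relevantPrimes G → ℕ → ∀ i, A i := fun p m =>
    if ∃ k : ℕ, (p : ℕ) ^ k • g m = 0 then g m else 0
  have hy : ∀ (p : OrderControllable.relevantPrimes G) (m : ℕ), y p m ∈
      OrderControllable.primaryPart (G ⊓ OrderControllable.finiteSupport A) (p : ℕ) := by
    intro p m
    simp only [y]
    split_ifs with h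
    · exact ⟨hg.mem m, h⟩
    · exact AddSubgroup.zero_mem _
  have hcoprime : ∀ {p q k l : ℕ} {x : ∀ i, A i}, p.Prime → q.Prime → p ^ k • x = 0 →
      q ^ l • x = 0 → x ≠ 0 → p = q := by
    intro p q k l x hp hq hk hl hx
    by_contra hpq
    refine hx (AddMonoid.addOrderOf_eq_one_iff.1 (Nat.dvd_one.1 ?_))
    have hc : Nat.Coprime (p ^ k) (q ^ l) := Nat.Coprime.pow _ _ ((Nat.coprime_primes hp hq).2 hpq)
    exact hc ▸ Nat.dvd_gcd (addOrderOf_dvd_of_nsmul_eq_zero hk) (addOrderOf_dvd_of_nsmul_eq_zero hl)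
  have hyg : ∀ n : OrderControllable.relevantPrimes G × ℕ, Function.uncurry y n ≠ 0 →
      Function.uncurry y n = g n.2 := fun n hn => by
    simp only [Function.uncurry, y] at hn ⊢
    split_ifs at hn ⊢ with h
    · rfl
    · exact absurd rfl hn
  have hyb : OrderControllable.IsProductBasis G (Function.uncurry y) := by
    refine hg.comap Prod.snd ?_ hyg fun m hm => ?_
    · rintro ⟨p, m⟩ hpm ⟨q, n⟩ hqn (rfl : m = n)
      obtain ⟨-, k, hk⟩ := hy p m
      obtain ⟨-, l, hl⟩ := hy q m
      have hp : y p m = g m := hyg (p, m) hpm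
      have hq : y q m = g m := hyg (q, m) hqn
      rw [hp] at hk
      rw [hq] at hl
      refine Prod.ext (Subtype.ext (hcoprime p.2.1 q.2.1 hk hl ?_)) rfl
      rw [← hp]
      exact hpm
    · obtain ⟨p, k, hp, hk⟩ := hgp m
      refine ⟨(⟨p, hp, g m, ⟨(hg.mem m).1, k, hk⟩, hm⟩, m), ?_, rfl⟩
      have h : ∃ k : ℕ, p ^ k • g m = 0 := ⟨k, hk⟩
      simpa only [Function.uncurry, y, if_pos h] using hm
  have hiSup : ⨆ n, AddSubgroup.zmultiples (Function.uncurry y n) ≤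
      ⨆ m, AddSubgroup.zmultiples (g m) := iSup_le fun n => by
    by_cases hn : Function.uncurry y n = 0
    · rw [hn, AddSubgroup.zmultiples_zero_eq_bot]; exact bot_le
    · rw [hyg n hn]; exact le_iSup (fun m => AddSubgroup.zmultiples (g m)) n.2
  refine ⟨y, ⟨?_, hy⟩, fun _ => ⟨?_, g, ?_⟩, fun hobs => ?_⟩
  · convert hyb.isTopologicallyGeneratedBy
  · convert hyb.exists_isIsomorphicEncoder hclosed
  · exact hg.exists_isIsomorphicEncoder hclosed
  have heq := hyb.iSup_eq hclosed fun p hp => ?_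
  · refine ⟨⟨?_, ?_⟩, g, hg.exists_isIsomorphicEncoder hclosed, ?_⟩
    · convert hyb.exists_isIsomorphicEncoder hclosed
    · rw [OrderControllable.range_sumHom, heq]
    · rw [OrderControllable.range_sumHom]
      exact le_antisymm hg.iSup_le (heq ▸ hiSup)
  -- Cyclic groups belonging to other primes have no `p`-torsion, so only the row of `p`
  -- contributes; for `p` outside `relevantPrimes G` the sum is trivial, hence closed.
  · have htors : ∀ (q : OrderControllable.relevantPrimes G) (m : ℕ), (q : ℕ) ≠ p →
        AddSubgroup.zmultiples (y q m) ⊓ AddSubgroup.torsionBy (∀ i, A i) (p : ℤ) = ⊥ := by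
      intro q m hqp
      rw [eq_bot_iff]
      rintro x ⟨hx, hpx⟩
      by_contra hx0
      have hpx' : (p : ℤ) • x = 0 := hpx
      obtain ⟨-, k, hk⟩ := AddSubgroup.zmultiples_le_of_mem (hy q m) hx
      refine hqp (hcoprime (k := k) (l := 1) q.2.1 hp hk ?_ hx0)
      rwa [pow_one, ← natCast_zsmul]
    by_cases hpG : p ∈ OrderControllable.relevantPrimes G
    · convert hobs ⟨p, hpG⟩ using 1
      rw [iSup_prod]
      refine le_antisymm (iSup_le fun q => ?_)
        (le_iSup (fun q => ⨆ m, AddSubgroup.zmultiples (Function.uncurry y (q, m)) ⊓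
          AddSubgroup.torsionBy (∀ i, A i) (p : ℤ)) ⟨p, hpG⟩)
      by_cases hq : (q : ℕ) = p
      · obtain rfl : q = ⟨p, hpG⟩ := Subtype.ext hq
        exact le_rfl
      · exact iSup_le fun m => (htors q m hq).le.trans bot_le
    · have hbot : ⨆ n, AddSubgroup.zmultiples (Function.uncurry y n) ⊓
          AddSubgroup.torsionBy (∀ i, A i) (p : ℤ) = ⊥ :=
        iSup_eq_bot.2 fun n => htors n.1 n.2 fun h => hpG (h ▸ n.1.2)
      rw [hbot, OrderControllable.IsWeaklyObservable, AddSubgroup.coe_bot, closure_singleton]
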